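/- Let $r\ge 2$ and $n\ge 1$ be integers, and let $\pi_1,\ldots,\pi_n$ be independent random permutations of $\{1,\ldots,r\}$, each uniformly distributed over all $r!$ permutations. Put $$X_{ij}=\frac{\sqrt{12}}{\sqrt{r(r+1)}}\Big(\pi_i(j)-\frac{r+1}{2}\Big),\qquad W_j=\frac{1}{\sqrt n}\sum_{i=1}^n X_{ij},\qquad F_r=\sum_{j=1}^r W_j^2,$$ so that $F_r$ is Friedman's statistic for $r$ treatments and $n$ trials under the null hypothesis. Let $h:[0,\infty)\to\mathbb{R}$ be four times differentiable (with one-sided derivatives at $0$), with bounded derivatives $h^{(1)},\ldots,h^{(4)}$, and set $$h_4=\sum_{j=1}^4 {4\brace j}\,\|h^{(j)}\|=\|h^{(1)}\|+7\|h^{(2)}\|+6\|h^{(3)}\|+\|h^{(4)}\|,$$ where ${4\brace j}$ are the Stirling numbers of the second kind and $\|h^{(j)}\|=\sup_{x\ge 0}|h^{(j)}(x)|$. Let $Y$ have the chi-square distribution with $r-1$ degrees of freedom. Then $h(F_r)$ and $h(Y)$ are integrable, and $$|\mathbb{E}h(F_r)-\mathbb{E}h(Y)|\le \frac{10797\, r^5}{n}\,h_4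 .$$ -/

import Mathlib

open MeasureTheory ProbabilityTheory Set

noncomputable section

namespace Friedman

/-- The class `C_b^m(ℝ⁺)`: real functions on `ℝ⁺ = [0, ∞)` that are `m` times differentiable there
(one-sided derivatives at `0`) and whose derivatives of the orders `1, …, m` are bounded.
Only the values of `h` on `[0, ∞)` matter. Neither continuity of the last derivative nor
boundedness of `h` itself is required. -/
structure MemCb (m : ℕ) (h : ℝ → ℝ) : Prop where
  differentiable : ∀ k < m, DifferentiableOn ℝ (iteratedDerivWithin k h (Ici 0)) (Ici 0)
  bounded : ∀ k ∈ Finset.Icc 1 m,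
    ∃ C : ℝ, ∀ x ∈ Ici (0 : ℝ), |iteratedDerivWithin k h (Ici 0) x| ≤ C

/-- The sup norm `‖h^{(k)}‖` of the `k`-th derivative over `[0, ∞)`. -/
def derivSupNorm (k : ℕ) (h : ℝ → ℝ) : ℝ :=
  ⨆ x : Ici (0 : ℝ), |iteratedDerivWithin k h (Ici 0) x|

/-- `h_m = ∑_{j=1}^m S(m, j) ‖h^{(j)}‖`, with the Stirling numbers of the second kind. -/
def hNorm (m : ℕ) (h : ℝ → ℝ) : ℝ :=
  ∑ j ∈ Finset.Icc 1 m, (Nat.stirlingSecond m j : ℝ) * derivSupNorm j h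

/-- The chi-square distribution with `k` degrees of freedom: the law of the sum of the squares of
`k` independent standard normal random variables. -/
def chiSquared (k : ℕ) : Measure ℝ :=
  (Measure.pi fun _ : Fin k => gaussianReal 0 1).map fun z => ∑ j, z j ^ 2

/-- The null hypothesis: `π₁, …, πₙ` are independent random permutations of the `r` treatments,
each of them uniformly distributed over all `r!` permutations. -/
structure NullHypothesis {Ω : Type*} [MeasurableSpace Ω] (μ : Measure Ω) {n r : ℕ}
    (π : Fin n → Ω → Equiv.Perm (Fin r)) : Prop where
  measurable : ∀ i σ, MeasurableSet (π i ⁻¹' {σ})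
  uniform : ∀ i σ, μ.real (π i ⁻¹' {σ}) = 1 / (Nat.factorial r : ℝ)
  indep : iIndepFun (m := fun _ => (⊤ : MeasurableSpace (Equiv.Perm (Fin r)))) π μ

/-- The standardised rank `√12 / √(r(r+1)) · (σ(j) - (r+1)/2)`. The rank `σ(j) ∈ {1, …, r}` of the
treatment `j` is `(σ j : ℕ) + 1`, since `Fin r` starts at `0`. -/
def X {r : ℕ} (σ : Equiv.Perm (Fin r)) (j : Fin r) : ℝ :=
  √12 / √((r : ℝ) * (r + 1)) * ((((σ j : ℕ) : ℝ) + 1) - ((r : ℝ) + 1) / 2)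

/-- `W_j = n^{-1/2} ∑ᵢ X_{ij}`. -/
def W {n r : ℕ} (ρ : Fin n → Equiv.Perm (Fin r)) (j : Fin r) : ℝ :=
  1 / √(n : ℝ) * ∑ i, X (ρ i) j

/-- Friedman's statistic `F_r = ∑ⱼ W_j²` of the `n` rankings `ρ`. -/
def friedman {n r : ℕ} (ρ : Fin n → Equiv.Perm (Fin r)) : ℝ :=
  ∑ j, W ρ j ^ 2

end Friedman

end

noncomputable section

namespace Friedman

/-! The vector of standardised ranks of one trial lies in the hyperplane of zero-sum vectors, of
dimension `d = r - 1`. There its covariance is the identity (`sum_inner_rankVector_sq`), its law is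
invariant under `x ↦ -x` because ranks can be reversed, and its norm is constantly `√(r - 1)`.
Friedman's statistic is `‖S‖²`, where `S` is `n^{-1/2}` times the sum of `n` independent such
vectors, and the chi-square law is that of `‖Z‖²` for `Z` standard Gaussian in the hyperplane.

The two are compared by Lindeberg's method: the `n` steps are exchanged one by one for Gaussian
steps of covariance `1/n`, whose sum is exactly `Z`. For one step `x` from `w`, `h` is expanded at
`‖w‖²` with increment `2⟨w, x⟩ + ‖x‖²`. Terms odd in `x` integrate to zero by symmetry, which is
what yields the rate `1/n` instead of `n^{-1/2}`. Terms quadratic in `x` see only the covariance and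
agree for both kinds of step. The rest is controlled by fourth and eighth moments of the step and
has order `n^{-2}` (`IsStep.abs_integral_sub_le`); summing over `n` exchanges gives `1/n`.

The error also involves `‖w‖²` and `‖w‖⁴`, so the partial sums need moment bounds uniform in their
length. `HasMoments` provides them, being stable under convolution. The resulting bound `d⁴ (3‖h''‖
+ 30‖h'''‖ + 166‖h''''‖) / n` is much stronger than the claim. -/

/-! ### Taylor's formula and growth of `h` on the half-line. -/

theorem abs_sub_le_of_hasDerivWithinAt_Icc {f f' : ℝ → ℝ} {M : ℝ} (k : ℕ)
    (hf : ∀ t ∈ Icc (0 : ℝ) 1, HasDerivWithinAt f (f' t) (Icc 0 1) t)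
    (hf0 : f 0 = 0) (hb : ∀ t ∈ Icc (0 : ℝ) 1, |f' t| ≤ M * t ^ k) :
    ∀ t ∈ Icc (0 : ℝ) 1, |f t| ≤ M / (k + 1) * t ^ (k + 1) := by
  have hB : ∀ x : ℝ, HasDerivAt (fun t : ℝ => M / (k + 1) * t ^ (k + 1)) (M * x ^ k) x := by
    intro x
    have := (hasDerivAt_pow (k + 1) x).const_mul (M / ((k : ℝ) + 1))
    refine this.congr_deriv ?_
    push_cast
    field_simp
  have := image_norm_le_of_norm_deriv_right_le_deriv_boundary (f := f) (f' := f')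
    (a := 0) (b := 1) (fun t ht => (hf t ht).continuousWithinAt)
    (fun t ht => ((hf t ⟨ht.1, ht.2.le⟩).mono_of_mem_nhdsWithin
      (Icc_mem_nhdsGE_of_mem ht)))
    (B := fun t : ℝ => M / (k + 1) * t ^ (k + 1)) (B' := fun t => M * t ^ k)
    (by simp [hf0]) hB (fun t ht => hb t ⟨ht.1, ht.2.le⟩)
  intro t ht
  exact this ht

/-- Taylor's formula of order four on `[0, 1]`, with a bounded fourth derivative. -/
theorem taylor_four_unit {f f1 f2 f3 f4 : ℝ → ℝ} {M : ℝ}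
    (h0 : ∀ t ∈ Icc (0 : ℝ) 1, HasDerivWithinAt f (f1 t) (Icc 0 1) t)
    (h1 : ∀ t ∈ Icc (0 : ℝ) 1, HasDerivWithinAt f1 (f2 t) (Icc 0 1) t)
    (h2 : ∀ t ∈ Icc (0 : ℝ) 1, HasDerivWithinAt f2 (f3 t) (Icc 0 1) t)
    (h3 : ∀ t ∈ Icc (0 : ℝ) 1, HasDerivWithinAt f3 (f4 t) (Icc 0 1) t)
    (hM : ∀ t ∈ Icc (0 : ℝ) 1, |f4 t| ≤ M) :
    |f 1 - (f 0 + f1 0 + f2 0 / 2 + f3 0 / 6)| ≤ M / 24 := by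
  -- The bound on `f4` is integrated four times, each pass subtracting one more Taylor term; the
  -- constants build up as `M`, `M/2`, `M/6`, `M/24`.
  have e3 := abs_sub_le_of_hasDerivWithinAt_Icc (f := fun t => f3 t - f3 0) (M := M) 0
    (fun t ht => (h3 t ht).sub_const _) (by simp) (by simpa using hM)
  have e2 := abs_sub_le_of_hasDerivWithinAt_Icc (f := fun t => f2 t - f2 0 - f3 0 * t) 1
    (f' := fun t => f3 t - f3 0)
    (fun t ht => by
      refine (((h2 t ht).sub_const (f2 0)).fun_sub
        (((hasDerivAt_id' t).const_mul (f3 0)).hasDerivWithinAt)).congr_deriv ?_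
      simp) (by simp) (by simpa using e3)
  have e1 := abs_sub_le_of_hasDerivWithinAt_Icc
    (f := fun t => f1 t - f1 0 - f2 0 * t - f3 0 / 2 * t ^ 2) 2
    (f' := fun t => f2 t - f2 0 - f3 0 * t)
    (fun t ht => by
      have := (((h1 t ht).sub_const (f1 0)).fun_sub
        (((hasDerivAt_id' t).const_mul (f2 0)).hasDerivWithinAt)).fun_sub
        (((hasDerivAt_pow 2 t).const_mul (f3 0 / 2)).hasDerivWithinAt)
      refine this.congr_deriv ?_
      simp; ring) (by simp) (by simpa using e2)
  have e0 := abs_sub_le_of_hasDerivWithinAt_Icc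
    (f := fun t => f t - f 0 - f1 0 * t - f2 0 / 2 * t ^ 2 - f3 0 / 6 * t ^ 3) 3
    (f' := fun t => f1 t - f1 0 - f2 0 * t - f3 0 / 2 * t ^ 2)
    (fun t ht => by
      have := ((((h0 t ht).sub_const (f 0)).fun_sub
        (((hasDerivAt_id' t).const_mul (f1 0)).hasDerivWithinAt)).fun_sub
        (((hasDerivAt_pow 2 t).const_mul (f2 0 / 2)).hasDerivWithinAt)).fun_sub
        (((hasDerivAt_pow 3 t).const_mul (f3 0 / 6)).hasDerivWithinAt)
      refine this.congr_deriv ?_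
      simp; ring) (by simp) (by simpa using e1)
  have := e0 1 (by simp)
  norm_num at this
  calc _ = |f 1 - f 0 - f1 0 - f2 0 / 2 - f3 0 / 6| := by congr 1; ring
    _ ≤ _ := this
    _ = _ := by ring

namespace MemCb

variable {m : ℕ} {h : ℝ → ℝ}

theorem hasDerivWithinAt (hh : MemCb m h) {k : ℕ} (hk : k < m) {x : ℝ} (hx : x ∈ Ici (0 : ℝ)) :
    HasDerivWithinAt (iteratedDerivWithin k h (Ici 0))
      (iteratedDerivWithin (k + 1) h (Ici 0) x) (Ici 0) x := by
  rw [iteratedDerivWithin_succ]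
  exact (hh.differentiable k hk x hx).hasDerivWithinAt

theorem abs_le_derivSupNorm (hh : MemCb m h) {k : ℕ} (hk : k ∈ Finset.Icc 1 m) {x : ℝ}
    (hx : x ∈ Ici (0 : ℝ)) : |iteratedDerivWithin k h (Ici 0) x| ≤ derivSupNorm k h := by
  obtain ⟨C, hC⟩ := hh.bounded k hk
  exact le_ciSup (f := fun x : Ici (0 : ℝ) => |iteratedDerivWithin k h (Ici 0) x|)
    ⟨C, by rintro _ ⟨y, rfl⟩; exact hC y y.2⟩ ⟨x, hx⟩

end MemCb

theorem derivSupNorm_nonneg (k : ℕ) (h : ℝ → ℝ) : 0 ≤ derivSupNorm k h :=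
  Real.iSup_nonneg fun _ => abs_nonneg _

/-- Taylor's formula for `h ∈ C_b^4` between two points of `[0, ∞)`. -/
theorem MemCb.taylor_four {h : ℝ → ℝ} (hh : MemCb 4 h) {a b : ℝ} (ha : 0 ≤ a) (hb : 0 ≤ b) :
    |h b - (h a + iteratedDerivWithin 1 h (Ici 0) a * (b - a)
        + iteratedDerivWithin 2 h (Ici 0) a * (b - a) ^ 2 / 2
        + iteratedDerivWithin 3 h (Ici 0) a * (b - a) ^ 3 / 6)|
      ≤ derivSupNorm 4 h * (b - a) ^ 4 / 24 := by
  have hmem : MapsTo (fun t : ℝ => a + t * (b - a)) (Icc 0 1) (Ici 0) := by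
    intro t ht
    show 0 ≤ a + t * (b - a)
    nlinarith [mul_nonneg ht.1 hb, mul_nonneg (sub_nonneg.2 ht.2) ha]
  have hline : ∀ t : ℝ, HasDerivWithinAt (fun t : ℝ => a + t * (b - a)) (b - a) (Icc 0 1) t := by
    intro t
    simpa using (((hasDerivAt_id' t).mul_const (b - a)).const_add a).hasDerivWithinAt
  have key : ∀ k < 4, ∀ t ∈ Icc (0 : ℝ) 1, HasDerivWithinAt
      (fun t => iteratedDerivWithin k h (Ici 0) (a + t * (b - a)) * (b - a) ^ k)
      (iteratedDerivWithin (k + 1) h (Ici 0) (a + t * (b - a)) * (b - a) ^ (k + 1)) (Icc 0 1) t := by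
    intro k hk t ht
    have := ((hh.hasDerivWithinAt hk (hmem ht)).comp t (hline t) hmem).mul_const ((b - a) ^ k)
    refine this.congr_deriv ?_
    ring
  have := taylor_four_unit (key 0 (by simp)) (key 1 (by simp)) (key 2 (by simp)) (key 3 (by simp))
    (M := derivSupNorm 4 h * (b - a) ^ 4) (fun t ht => by
      rw [abs_mul, abs_of_nonneg (a := (b - a) ^ 4) (by positivity)]
      exact mul_le_mul_of_nonneg_right (hh.abs_le_derivSupNorm (by simp) (hmem ht)) (by positivity))
  simpa using this

theorem MemCb.continuousOn {h : ℝ → ℝ} (hh : MemCb 4 h) : ContinuousOn h (Ici 0) := by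
  simpa using (hh.differentiable 0 (by simp)).continuousOn

theorem MemCb.abs_le_add_mul {h : ℝ → ℝ} (hh : MemCb 4 h) {x : ℝ} (hx : 0 ≤ x) :
    |h x| ≤ |h 0| + derivSupNorm 1 h * x := by
  have := (convex_Ici (0 : ℝ)).norm_image_sub_le_of_norm_hasDerivWithin_le
    (fun y hy => hh.hasDerivWithinAt (k := 0) (by simp) hy)
    (fun y hy => hh.abs_le_derivSupNorm (k := 1) (by simp) hy)
    (show (0 : ℝ) ∈ Ici 0 by simp) (show x ∈ Ici 0 from hx)
  simp only [iteratedDerivWithin_zero, Real.norm_eq_abs, sub_zero, abs_of_nonneg hx] at this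
  have h2 := abs_sub_abs_le_abs_sub (h x) (h 0)
  linarith

theorem integrable_of_abs_le_pow {E : Type*} [NormedAddCommGroup E] [MeasurableSpace E]
    [OpensMeasurableSpace E] [SecondCountableTopology E] {ν : Measure E}
    [IsProbabilityMeasure ν] {l : ℕ}
    (hν : Integrable (fun x => ‖x‖ ^ l) ν) {f : E → ℝ} (hf : Continuous f) (C : ℝ)
    (hC : ∀ x, |f x| ≤ C * (1 + ‖x‖ ^ l)) : Integrable f ν :=
  (((integrable_const (1 : ℝ)).add hν).const_mul C).mono' hf.aestronglyMeasurable
    (Filter.Eventually.of_forall hC)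

/-! ### Moment conditions and convolution. -/

section Moments

variable {E : Type*} [NormedAddCommGroup E] [InnerProductSpace ℝ E] [MeasurableSpace E]

/-- Moment conditions, stable under convolution, on a centred law whose covariance has
trace `c * dim E`. -/
structure HasMoments (c : ℝ) (ν : Measure E) : Prop where
  integrable : Integrable (fun x => ‖x‖ ^ 4) ν
  mean : ∀ w : E, ∫ x, inner ℝ w x ∂ν = 0
  sq : ∫ x, ‖x‖ ^ 2 ∂ν = c * Module.finrank ℝ E
  four : ∫ x, ‖x‖ ^ 4 ∂ν ≤ 3 * (c * Module.finrank ℝ E) ^ 2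

/-- A symmetric law with covariance `c` times the identity and a bound on the eighth moment. -/
structure IsStep (c : ℝ) (ν : Measure E) : Prop extends HasMoments c ν where
  symm : ν.map (fun x => -x) = ν
  cov : ∀ w : E, ∫ x, inner ℝ w x ^ 2 ∂ν = c * ‖w‖ ^ 2
  integrable_eight : Integrable (fun x => ‖x‖ ^ 8) ν
  eight : ∫ x, ‖x‖ ^ 8 ∂ν ≤ 105 * (c * Module.finrank ℝ E) ^ 4

theorem pow_le_one_add_pow {t : ℝ} (ht : 0 ≤ t) {k l : ℕ} (hkl : k ≤ l) : t ^ k ≤ 1 + t ^ l := by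
  rcases le_total t 1 with h | h
  · have := pow_le_one₀ ht h (n := k)
    have := pow_nonneg ht l
    linarith
  · have := pow_le_pow_right₀ h hkl
    linarith

theorem hasMoments_dirac_zero [BorelSpace E] : HasMoments 0 (Measure.dirac (0 : E)) where
  integrable := integrable_dirac (by simp)
  mean w := by rw [integral_dirac]; simp
  sq := by rw [integral_dirac]; simp
  four := by rw [integral_dirac]; simp

variable [FiniteDimensional ℝ E] [BorelSpace E]

/-- Cross terms linear in one of the two variables vanish by centring. The constant 3 survives in
the fourth moment because the surviving mixed term is at most `6st` and `3s² + 6st + 3t² = 3(s +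
t)²`. -/
theorem HasMoments.conv {c c' : ℝ} {μ ν : Measure E} [IsProbabilityMeasure μ]
    [IsProbabilityMeasure ν] (hμ : HasMoments c μ) (hν : HasMoments c' ν) :
    HasMoments (c + c') (μ ∗ ν) := by
  have dom : ∀ F : E × E → ℝ, Continuous F →
      (∀ x y, |F (x, y)| ≤ 8 * (1 + ‖x‖ ^ 4 + ‖y‖ ^ 4)) → Integrable F (μ.prod ν) := by
    intro F hF hb
    exact ((((integrable_const (1 : ℝ)).add (hμ.integrable.comp_fst ν)).add
      (hν.integrable.comp_snd μ)).const_mul 8).mono' hF.aestronglyMeasurable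
      (Filter.Eventually.of_forall fun z => hb z.1 z.2)
  have hin : ∀ x y : E, |inner ℝ x y| ≤ ‖x‖ * ‖y‖ := abs_real_inner_le_norm
  have hmap : ∀ f : E → ℝ, Continuous f →
      ∫ x, f x ∂(μ ∗ ν) = ∫ z, f (z.1 + z.2) ∂(μ.prod ν) := fun f hf =>
    integral_map (by fun_prop) hf.aestronglyMeasurable
  have i2 : Integrable (fun x => ‖x‖ ^ 2) μ := integrable_of_abs_le_pow hμ.integrable
    (by fun_prop) 1 fun x => by
      rw [abs_of_nonneg (by positivity), one_mul]
      exact pow_le_one_add_pow (norm_nonneg x) (by norm_num)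
  have j2 : Integrable (fun x => ‖x‖ ^ 2) ν := integrable_of_abs_le_pow hν.integrable
    (by fun_prop) 1 fun x => by
      rw [abs_of_nonneg (by positivity), one_mul]
      exact pow_le_one_add_pow (norm_nonneg x) (by norm_num)
  have p4 : Integrable (fun z : E × E => ‖z.1 + z.2‖ ^ 4) (μ.prod ν) := dom _ (by fun_prop) (by
    intro x y
    rw [abs_of_nonneg (by positivity)]
    calc ‖x + y‖ ^ 4 ≤ (‖x‖ + ‖y‖) ^ 4 := by gcongr; exact norm_add_le x y
      _ ≤ 2 ^ 3 * (‖x‖ ^ 4 + ‖y‖ ^ 4) := add_pow_le (norm_nonneg x) (norm_nonneg y) 4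
      _ ≤ _ := by linarith)
  have k1 : Integrable (fun z : E × E => ‖z.1‖ ^ 2 * inner ℝ z.1 z.2) (μ.prod ν) :=
    dom _ (by fun_prop) (by
      intro x y
      rw [abs_mul, abs_of_nonneg (by positivity)]
      have := mul_le_mul_of_nonneg_left (hin x y) (sq_nonneg ‖x‖)
      nlinarith [sq_nonneg (‖x‖ ^ 2 - ‖x‖ * ‖y‖), sq_nonneg (‖x‖ ^ 2 - ‖y‖ ^ 2)])
  have k2 : Integrable (fun z : E × E => ‖z.2‖ ^ 2 * inner ℝ z.1 z.2) (μ.prod ν) :=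
    dom _ (by fun_prop) (by
      intro x y
      rw [abs_mul, abs_of_nonneg (by positivity)]
      have := mul_le_mul_of_nonneg_left (hin x y) (sq_nonneg ‖y‖)
      nlinarith [sq_nonneg (‖y‖ ^ 2 - ‖x‖ * ‖y‖), sq_nonneg (‖x‖ ^ 2 - ‖y‖ ^ 2)])
  have k3 : Integrable (fun z : E × E => inner ℝ z.1 z.2) (μ.prod ν) :=
    dom _ (by fun_prop) (by
      intro x y
      have := hin x y
      dsimp only
      nlinarith [sq_nonneg (‖x‖ - ‖y‖), sq_nonneg (‖x‖ ^ 2 - 1), sq_nonneg (‖y‖ ^ 2 - 1)])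
  have z1 : ∫ z : E × E, ‖z.1‖ ^ 2 * inner ℝ z.1 z.2 ∂(μ.prod ν) = 0 := by
    rw [integral_prod _ k1]
    simp [integral_const_mul, hν.mean]
  have z2 : ∫ z : E × E, ‖z.2‖ ^ 2 * inner ℝ z.1 z.2 ∂(μ.prod ν) = 0 := by
    rw [integral_prod_symm _ k2]
    simp_rw [integral_const_mul, real_inner_comm, hμ.mean]
    simp
  have z3 : ∫ z : E × E, inner ℝ z.1 z.2 ∂(μ.prod ν) = 0 := by
    rw [integral_prod _ k3]
    simp [hν.mean]
  refine ⟨?_, fun w => ?_, ?_, ?_⟩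
  · exact (integrable_map_measure (by fun_prop) (by fun_prop)).2 p4
  · rw [hmap _ (by fun_prop)]
    have a1 : Integrable (fun x => inner ℝ w x) μ := integrable_of_abs_le_pow hμ.integrable
      (by fun_prop) ‖w‖ fun x => (hin w x).trans (mul_le_mul_of_nonneg_left
        (by simpa using pow_le_one_add_pow (norm_nonneg x) (show 1 ≤ 4 by norm_num))
        (norm_nonneg w))
    have a2 : Integrable (fun x => inner ℝ w x) ν := integrable_of_abs_le_pow hν.integrable
      (by fun_prop) ‖w‖ fun x => (hin w x).trans (mul_le_mul_of_nonneg_left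
        (by simpa using pow_le_one_add_pow (norm_nonneg x) (show 1 ≤ 4 by norm_num))
        (norm_nonneg w))
    simp_rw [inner_add_right]
    rw [integral_add (a1.comp_fst ν) (a2.comp_snd μ), integral_fun_fst (f := fun x => inner ℝ w x),
      integral_fun_snd (f := fun x => inner ℝ w x), hμ.mean, hν.mean]
    simp
  · rw [hmap _ (by fun_prop)]
    simp_rw [norm_add_sq_real]
    rw [integral_add ((i2.comp_fst ν).fun_add (k3.const_mul 2)) (j2.comp_snd μ),
      integral_add (i2.comp_fst ν) (k3.const_mul 2), integral_const_mul, z3,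
      integral_fun_fst (f := fun x : E => ‖x‖ ^ 2), integral_fun_snd (f := fun x : E => ‖x‖ ^ 2),
      hμ.sq, hν.sq]
    simp
    ring
  · rw [hmap _ (by fun_prop)]
    have i22 := i2.mul_prod j2
    -- The 6 is `2 + 4`: the square of `‖x‖² + ‖y‖² + 2⟨x, y⟩` contains `2‖x‖²‖y‖²` and `4⟨x, y⟩²`,
    -- the latter bounded by Cauchy–Schwarz.
    have hle : ∀ z : E × E, ‖z.1 + z.2‖ ^ 4 ≤ (‖z.1‖ ^ 4 + ‖z.2‖ ^ 4
        + 6 * (‖z.1‖ ^ 2 * ‖z.2‖ ^ 2)) + (4 * (‖z.1‖ ^ 2 * inner ℝ z.1 z.2)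
        + 4 * (‖z.2‖ ^ 2 * inner ℝ z.1 z.2)) := by
      intro z
      have h1 : ‖z.1 + z.2‖ ^ 4 = (‖z.1 + z.2‖ ^ 2) ^ 2 := by ring
      rw [h1, norm_add_sq_real]
      have h2 : (inner ℝ z.1 z.2) ^ 2 ≤ (‖z.1‖ * ‖z.2‖) ^ 2 := by
        rw [← sq_abs]
        gcongr
        exact hin _ _
      nlinarith
    have s1 := ((hμ.integrable.comp_fst ν).fun_add (hν.integrable.comp_snd μ)).fun_add
      (i22.const_mul 6)
    have s2 := (k1.const_mul 4).fun_add (k2.const_mul 4)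
    refine (integral_mono p4 (s1.fun_add s2) hle).trans ?_
    rw [integral_add s1 s2, integral_add (k1.const_mul 4) (k2.const_mul 4),
      integral_add ((hμ.integrable.comp_fst ν).fun_add (hν.integrable.comp_snd μ)) (i22.const_mul 6),
      integral_add (hμ.integrable.comp_fst ν) (hν.integrable.comp_snd μ),
      integral_const_mul, integral_const_mul, integral_const_mul, z1, z2,
      integral_fun_fst (f := fun x : E => ‖x‖ ^ 4), integral_fun_snd (f := fun x : E => ‖x‖ ^ 4),
      integral_prod_mul (fun x : E => ‖x‖ ^ 2) (fun x : E => ‖x‖ ^ 2), hμ.sq, hν.sq]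
    simp only [probReal_univ, one_smul]
    nlinarith [hμ.four, hν.four]

end Moments

/-! ### The effect of a single step. -/

section OneStep

/-- Reflection shows that the integral equals its own negative; no integrability is needed. -/
theorem integral_eq_zero_of_odd {E : Type*} [NormedAddCommGroup E] [MeasurableSpace E]
    [BorelSpace E] [SecondCountableTopology E] {ν : Measure E}
    (hν : ν.map (fun x => -x) = ν) {f : E → ℝ}
    (hf : Continuous f) (hodd : ∀ x, f (-x) = -f x) : ∫ x, f x ∂ν = 0 := by
  have h1 : ∫ x, f x ∂ν = ∫ x, f (-x) ∂ν := by
    conv_lhs => rw [← hν]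
    exact integral_map (by fun_prop) hf.aestronglyMeasurable
  simp_rw [hodd, integral_neg] at h1
  linarith

theorem MemCb.continuous_comp_norm_sq {E : Type*} [NormedAddCommGroup E] {h : ℝ → ℝ}
    (hh : MemCb 4 h) : Continuous fun x : E => h (‖x‖ ^ 2) :=
  hh.continuousOn.comp_continuous (by fun_prop) fun x => sq_nonneg ‖x‖

/-- Taylor expansion of `h (‖w + x‖²)`, with the odd part in `x` separated. -/
theorem MemCb.taylor_norm_sq {E : Type*} [NormedAddCommGroup E] [InnerProductSpace ℝ E]
    {h : ℝ → ℝ} (hh : MemCb 4 h) (w x : E) :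
    |h (‖w + x‖ ^ 2) - (h (‖w‖ ^ 2) + iteratedDerivWithin 1 h (Ici 0) (‖w‖ ^ 2) * ‖x‖ ^ 2
        + 2 * iteratedDerivWithin 2 h (Ici 0) (‖w‖ ^ 2) * inner ℝ w x ^ 2
        + (2 * iteratedDerivWithin 1 h (Ici 0) (‖w‖ ^ 2) * inner ℝ w x
          + 2 * iteratedDerivWithin 2 h (Ici 0) (‖w‖ ^ 2) * (inner ℝ w x * ‖x‖ ^ 2)
          + iteratedDerivWithin 3 h (Ici 0) (‖w‖ ^ 2)
            * (4 / 3 * inner ℝ w x ^ 3 + inner ℝ w x * ‖x‖ ^ 4)))|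
      ≤ (derivSupNorm 2 h / 2 + derivSupNorm 3 h * (2 * ‖w‖ ^ 2 + 1 / 12)
            + derivSupNorm 4 h * (16 / 3 * ‖w‖ ^ 4)) * ‖x‖ ^ 4
          + (derivSupNorm 3 h / 12 + derivSupNorm 4 h / 3) * ‖x‖ ^ 8 := by
  have hT := hh.taylor_four (sq_nonneg ‖w‖) (sq_nonneg ‖w + x‖)
  have hd : ‖w + x‖ ^ 2 - ‖w‖ ^ 2 = 2 * inner ℝ w x + ‖x‖ ^ 2 := by
    rw [norm_add_sq_real]; ring
  rw [hd] at hT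
  have hp : inner ℝ w x ^ 2 ≤ ‖w‖ ^ 2 * ‖x‖ ^ 2 := by
    rw [← sq_abs, ← mul_pow]
    gcongr
    exact abs_real_inner_le_norm w x
  have b2 := hh.abs_le_derivSupNorm (k := 2) (by simp) (sq_nonneg ‖w‖ : ‖w‖ ^ 2 ∈ Ici (0 : ℝ))
  have b3 := hh.abs_le_derivSupNorm (k := 3) (by simp) (sq_nonneg ‖w‖ : ‖w‖ ^ 2 ∈ Ici (0 : ℝ))
  have b4 := derivSupNorm_nonneg 4 h
  have hs : 0 ≤ ‖x‖ ^ 2 := sq_nonneg _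
  have e4 : ‖x‖ ^ 4 = (‖x‖ ^ 2) ^ 2 := by ring
  have e8 : ‖x‖ ^ 8 = (‖x‖ ^ 2) ^ 4 := by ring
  have ew : ‖w‖ ^ 4 = (‖w‖ ^ 2) ^ 2 := by ring
  rw [e4, e8, ew]
  generalize iteratedDerivWithin 1 h (Ici 0) (‖w‖ ^ 2) = H1 at *
  generalize iteratedDerivWithin 2 h (Ici 0) (‖w‖ ^ 2) = H2 at *
  generalize iteratedDerivWithin 3 h (Ici 0) (‖w‖ ^ 2) = H3 at *
  generalize derivSupNorm 2 h = D2 at *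
  generalize derivSupNorm 3 h = D3 at *
  generalize derivSupNorm 4 h = D4 at *
  generalize h (‖w + x‖ ^ 2) = A at *
  generalize h (‖w‖ ^ 2) = B at *
  have hq : 0 ≤ ‖w‖ ^ 2 := sq_nonneg _
  generalize ‖w‖ ^ 2 = q at *
  generalize ‖x‖ ^ 2 = s at *
  generalize inner ℝ w x = p at *
  -- With `p = ⟨w, x⟩` and `s = ‖x‖²`, the even parts not kept in the expansion are `s²/2` from `(2p
  -- + s)²/2` and `2p²s + s³/6` from `(2p + s)³/6`. The power `s³` is split between `s²` and `s⁴`,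
  -- so that only fourth and eighth moments occur.
  have r2 : |H2 * (s ^ 2 / 2)| ≤ D2 * (s ^ 2 / 2) := by
    rw [abs_mul, abs_of_nonneg (a := s ^ 2 / 2) (by positivity)]
    gcongr
  have r3 : |H3 * (2 * p ^ 2 * s + s ^ 3 / 6)| ≤ D3 * (2 * (q * s) * s + (s ^ 2 + s ^ 4) / 12) := by
    rw [abs_mul, abs_of_nonneg (a := 2 * p ^ 2 * s + s ^ 3 / 6) (by positivity)]
    have : s ^ 3 ≤ (s ^ 2 + s ^ 4) / 2 := by nlinarith [mul_nonneg hs hs, sq_nonneg (s * (s - 1))]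
    have h1 : 2 * p ^ 2 * s + s ^ 3 / 6 ≤ 2 * (q * s) * s + (s ^ 2 + s ^ 4) / 12 := by
      have := mul_le_mul_of_nonneg_right hp hs
      linarith
    exact mul_le_mul b3 h1 (by positivity) ((abs_nonneg _).trans b3)
  have r4 : D4 * (2 * p + s) ^ 4 / 24 ≤ D4 * (16 / 3 * (q * s) ^ 2 + s ^ 4 / 3) := by
    have h1 : (2 * p + s) ^ 4 ≤ 8 * (16 * (p ^ 2) ^ 2 + s ^ 4) := by
      nlinarith [sq_nonneg ((2 * p) ^ 2 - s ^ 2), sq_nonneg (2 * p - s),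
        mul_nonneg (sq_nonneg (2 * p - s)) (sq_nonneg (2 * p + s)), sq_nonneg ((2 * p - s) ^ 2)]
    have h2 : (p ^ 2) ^ 2 ≤ (q * s) ^ 2 := by gcongr
    have := mul_le_mul_of_nonneg_left (show (2 * p + s) ^ 4 / 24 ≤ 16 / 3 * (q * s) ^ 2 + s ^ 4 / 3
      by linarith) b4
    linarith
  rw [abs_le] at hT r2 r3 ⊢
  constructor <;> nlinarith [hT.1, hT.2, r2.1, r2.2, r3.1, r3.2]

variable {E : Type*} [NormedAddCommGroup E] [InnerProductSpace ℝ E] [MeasurableSpace E]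
  [FiniteDimensional ℝ E] [BorelSpace E]

theorem MemCb.integrable_comp_norm_sq {h : ℝ → ℝ} (hh : MemCb 4 h) {c : ℝ} {ν : Measure E}
    [IsProbabilityMeasure ν] (hν : HasMoments c ν) : Integrable (fun x => h (‖x‖ ^ 2)) ν := by
  refine integrable_of_abs_le_pow hν.integrable hh.continuous_comp_norm_sq
    (|h 0| + derivSupNorm 1 h) fun x => (hh.abs_le_add_mul (sq_nonneg _)).trans ?_
  have h1 := pow_le_one_add_pow (norm_nonneg x) (show 2 ≤ 4 by norm_num)
  have h2 := mul_le_mul_of_nonneg_left h1 (derivSupNorm_nonneg 1 h)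
  have h3 := mul_nonneg (abs_nonneg (h 0)) (pow_nonneg (norm_nonneg x) 4)
  linarith

/-- The bound on the effect of one step of a random walk started at `w`. -/
theorem IsStep.abs_integral_sub_le {h : ℝ → ℝ} (hh : MemCb 4 h) {c : ℝ} {ν : Measure E}
    [IsProbabilityMeasure ν] (hν : IsStep c ν) (w : E) :
    |∫ x, h (‖w + x‖ ^ 2) ∂ν - (h (‖w‖ ^ 2)
        + iteratedDerivWithin 1 h (Ici 0) (‖w‖ ^ 2) * (c * Module.finrank ℝ E)
        + 2 * iteratedDerivWithin 2 h (Ici 0) (‖w‖ ^ 2) * (c * ‖w‖ ^ 2))|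
      ≤ (derivSupNorm 2 h / 2 + derivSupNorm 3 h * (2 * ‖w‖ ^ 2 + 1 / 12)
            + derivSupNorm 4 h * (16 / 3 * ‖w‖ ^ 4)) * (3 * (c * Module.finrank ℝ E) ^ 2)
          + (derivSupNorm 3 h / 12 + derivSupNorm 4 h / 3)
            * (105 * (c * Module.finrank ℝ E) ^ 4) := by
  have hin : ∀ x : E, |inner ℝ w x| ≤ ‖w‖ * ‖x‖ := abs_real_inner_le_norm w
  have ipow : ∀ k ≤ 8, Integrable (fun x : E => ‖x‖ ^ k) ν := fun k hk =>
    integrable_of_abs_le_pow hν.integrable_eight (by fun_prop) 1 fun x => by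
      rw [abs_of_nonneg (by positivity), one_mul]
      exact pow_le_one_add_pow (norm_nonneg x) hk
  have imix : ∀ k l, k + l ≤ 8 → Integrable (fun x : E => inner ℝ w x ^ k * ‖x‖ ^ l) ν :=
    fun k l hk => integrable_of_abs_le_pow hν.integrable_eight (by fun_prop) (‖w‖ ^ k) fun x => by
      rw [abs_mul, abs_pow, abs_of_nonneg (a := ‖x‖ ^ l) (by positivity)]
      calc |inner ℝ w x| ^ k * ‖x‖ ^ l ≤ (‖w‖ * ‖x‖) ^ k * ‖x‖ ^ l := by gcongr; exact hin x
        _ = ‖w‖ ^ k * ‖x‖ ^ (k + l) := by ring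
        _ ≤ _ := by gcongr; exact pow_le_one_add_pow (norm_nonneg x) hk
  have ihh : Integrable (fun x : E => h (‖w + x‖ ^ 2)) ν := by
    refine integrable_of_abs_le_pow hν.integrable
      (hh.continuous_comp_norm_sq.comp (continuous_const.add continuous_id))
      (|h 0| + derivSupNorm 1 h * (2 * ‖w‖ ^ 2 + 2)) fun x =>
      (hh.abs_le_add_mul (sq_nonneg _)).trans ?_
    have h1 := pow_le_one_add_pow (norm_nonneg x) (show 2 ≤ 4 by norm_num)
    have h3 := mul_nonneg (abs_nonneg (h 0)) (pow_nonneg (norm_nonneg x) 4)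
    have h4 : ‖w + x‖ ^ 2 ≤ 2 * ‖w‖ ^ 2 + 2 * ‖x‖ ^ 2 := by
      have := pow_le_pow_left₀ (norm_nonneg _) (norm_add_le w x) 2
      nlinarith [sq_nonneg (‖w‖ - ‖x‖)]
    have h5 : 0 ≤ ‖w‖ ^ 2 * ‖x‖ ^ 4 := by positivity
    have h2 := mul_le_mul_of_nonneg_left (show ‖w + x‖ ^ 2 ≤ (2 * ‖w‖ ^ 2 + 2) * (1 + ‖x‖ ^ 4) by
      linarith) (derivSupNorm_nonneg 1 h)
    linarith
  set H1 := iteratedDerivWithin 1 h (Ici 0) (‖w‖ ^ 2)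
  set H2 := iteratedDerivWithin 2 h (Ici 0) (‖w‖ ^ 2)
  set H3 := iteratedDerivWithin 3 h (Ici 0) (‖w‖ ^ 2)
  set A := derivSupNorm 2 h / 2 + derivSupNorm 3 h * (2 * ‖w‖ ^ 2 + 1 / 12)
            + derivSupNorm 4 h * (16 / 3 * ‖w‖ ^ 4) with hA
  set B := derivSupNorm 3 h / 12 + derivSupNorm 4 h / 3 with hB
  have hA0 : 0 ≤ A := by
    have := derivSupNorm_nonneg 2 h
    have := derivSupNorm_nonneg 3 h
    have := derivSupNorm_nonneg 4 h
    positivity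
  have hB0 : 0 ≤ B := by
    have := derivSupNorm_nonneg 3 h
    have := derivSupNorm_nonneg 4 h
    positivity
  let odd : E → ℝ := fun x => 2 * H1 * inner ℝ w x + 2 * H2 * (inner ℝ w x * ‖x‖ ^ 2)
          + H3 * (4 / 3 * inner ℝ w x ^ 3 + inner ℝ w x * ‖x‖ ^ 4)
  have hodd : ∫ x, odd x ∂ν = 0 := integral_eq_zero_of_odd hν.symm (by fun_prop) fun x => by
    simp only [odd, inner_neg_right, norm_neg]; ring
  have iodd : Integrable odd ν := by
    have h1 := (imix 1 0 (by norm_num)).const_mul (2 * H1)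
    have h2 := (imix 1 2 (by norm_num)).const_mul (2 * H2)
    have h3 := (((imix 3 0 (by norm_num)).const_mul (4 / 3)).fun_add
      (imix 1 4 (by norm_num))).const_mul H3
    simpa using (h1.fun_add h2).fun_add h3
  have icov : Integrable (fun x : E => inner ℝ w x ^ 2) ν := by
    simpa using imix 2 0 (by norm_num)
  have i0 : Integrable (fun _ : E => h (‖w‖ ^ 2)) ν := integrable_const _
  have i1 := (ipow 2 (by norm_num)).const_mul H1
  have i2 := icov.const_mul (2 * H2)
  have hmain : ∫ x, (h (‖w‖ ^ 2) + H1 * ‖x‖ ^ 2 + 2 * H2 * inner ℝ w x ^ 2 + odd x) ∂ν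
      = h (‖w‖ ^ 2) + H1 * (c * Module.finrank ℝ E) + 2 * H2 * (c * ‖w‖ ^ 2) := by
    rw [integral_add ((i0.fun_add i1).fun_add i2) iodd, integral_add (i0.fun_add i1) i2,
      integral_add i0 i1, integral_const_mul, integral_const_mul, hν.sq, hν.cov, hodd]
    simp
  rw [← hmain, ← integral_sub ihh (((i0.fun_add i1).fun_add i2).fun_add iodd)]
  have hb : ∀ x : E, ‖h (‖w + x‖ ^ 2)
      - (h (‖w‖ ^ 2) + H1 * ‖x‖ ^ 2 + 2 * H2 * inner ℝ w x ^ 2 + odd x)‖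
      ≤ A * ‖x‖ ^ 4 + B * ‖x‖ ^ 8 := fun x => hh.taylor_norm_sq w x
  have ib := ((ipow 4 (by norm_num)).const_mul A).fun_add ((ipow 8 le_rfl).const_mul B)
  refine (norm_integral_le_of_norm_le ib (Filter.Eventually.of_forall hb)).trans ?_
  rw [integral_add ((ipow 4 (by norm_num)).const_mul A) ((ipow 8 le_rfl).const_mul B),
    integral_const_mul, integral_const_mul]
  gcongr
  · exact hν.four
  · exact hν.eight

end OneStep

/-! ### Gaussian moments and stability of the Gaussian law. -/

/-- The integral is a value of Gamma at a half-integer. For `k = 0` the truncated `2 * k - 1` is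
`0`, with double factorial `1`, as it should be. -/
theorem integral_pow_two_mul_gaussianReal (k : ℕ) :
    ∫ x, x ^ (2 * k) ∂(gaussianReal 0 1) = ((2 * k - 1).doubleFactorial : ℝ) := by
  rw [integral_gaussianReal_eq_integral_smul one_ne_zero]
  have h1 : ∀ x : ℝ, gaussianPDFReal 0 1 x • x ^ (2 * k)
      = (√(2 * Real.pi))⁻¹ * (|x| ^ ((2 * k : ℕ) : ℝ) * Real.exp (-(1 / 2) * |x| ^ (2 : ℝ))) := by
    intro x
    rw [Real.rpow_natCast, Real.rpow_two, sq_abs, (even_two_mul k).pow_abs, gaussianPDFReal]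
    simp
    ring_nf
  simp_rw [h1]
  rw [integral_const_mul, integral_comp_abs
    (f := fun x : ℝ => x ^ ((2 * k : ℕ) : ℝ) * Real.exp (-(1 / 2) * x ^ (2 : ℝ))),
    integral_rpow_mul_exp_neg_mul_rpow (by norm_num)
      (lt_of_lt_of_le (by norm_num) (Nat.cast_nonneg _)) (by norm_num)]
  have h2 : (((2 * k : ℕ) : ℝ) + 1) / 2 = (k : ℝ) + 1 / 2 := by push_cast; ring
  have h3 : -(((2 * k : ℕ) : ℝ) + 1) / 2 = -((k : ℝ) + 1 / 2) := by push_cast; ring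
  rw [h2, h3, Real.Gamma_nat_add_half, one_div (2 : ℝ), Real.inv_rpow (by norm_num),
    Real.rpow_neg (by norm_num), inv_inv, Real.rpow_add (by norm_num), Real.rpow_natCast,
    ← one_div (2 : ℝ), ← Real.sqrt_eq_rpow, Real.sqrt_mul (by norm_num)]
  field_simp

section StandardGaussian

variable {E : Type*} [NormedAddCommGroup E] [InnerProductSpace ℝ E] [MeasurableSpace E]
  [FiniteDimensional ℝ E] [BorelSpace E]

theorem IsStep.map_smul {c : ℝ} {ν : Measure E} (hν : IsStep c ν) (a : ℝ) :
    IsStep (a ^ 2 * c) (ν.map fun x => a • x) := by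
  have hm : ∀ f : E → ℝ, Continuous f → ∫ x, f x ∂(ν.map fun x => a • x) = ∫ x, f (a • x) ∂ν :=
    fun f hf => integral_map (by fun_prop) hf.aestronglyMeasurable
  have hi : ∀ k : ℕ, Integrable (fun x => ‖x‖ ^ k) ν →
      Integrable (fun x => ‖x‖ ^ k) (ν.map fun x => a • x) := fun k hk => by
    refine (integrable_map_measure (by fun_prop) (by fun_prop)).2 ?_
    simpa [Function.comp_def, norm_smul, mul_pow] using hk.const_mul (|a| ^ k)
  refine ⟨⟨hi 4 hν.integrable, fun w => ?_, ?_, ?_⟩, ?_, fun w => ?_, hi 8 hν.integrable_eight, ?_⟩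
  · rw [hm _ (by fun_prop)]
    simp [inner_smul_right, integral_const_mul, hν.mean]
  · rw [hm _ (by fun_prop)]
    simp only [norm_smul, mul_pow, integral_const_mul, hν.sq, Real.norm_eq_abs, sq_abs]
    ring
  · rw [hm _ (by fun_prop)]
    simp only [norm_smul, mul_pow, integral_const_mul, Real.norm_eq_abs]
    have h1 : |a| ^ 4 = (a ^ 2) ^ 2 := by rw [← sq_abs a]; ring
    rw [h1]
    nlinarith [mul_le_mul_of_nonneg_left hν.four (sq_nonneg (a ^ 2))]
  · rw [Measure.map_map (by fun_prop) (by fun_prop)]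
    conv_rhs => rw [← hν.symm]
    rw [Measure.map_map (by fun_prop) (by fun_prop)]
    simp [Function.comp_def]
  · rw [hm _ (by fun_prop)]
    simp only [inner_smul_right, mul_pow, integral_const_mul, hν.cov]
    ring
  · rw [hm _ (by fun_prop)]
    simp only [norm_smul, mul_pow, integral_const_mul, Real.norm_eq_abs]
    have h1 : |a| ^ 8 = (a ^ 2) ^ 4 := by rw [← sq_abs a]; ring
    rw [h1]
    have := mul_le_mul_of_nonneg_left hν.eight (show 0 ≤ (a ^ 2) ^ 4 by positivity)
    linarith

theorem map_inner_stdGaussian {v : E} (hv : ‖v‖ = 1) :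
    (stdGaussian E).map (fun x => inner ℝ v x) = gaussianReal 0 1 := by
  have := IsGaussian.map_eq_gaussianReal (μ := stdGaussian E) (innerSL ℝ v)
  rw [integral_strongDual_stdGaussian, variance_dual_stdGaussian, innerSL_apply_norm, hv] at this
  simpa using this

theorem integral_inner_pow_two_mul_stdGaussian {v : E} (hv : ‖v‖ = 1) (k : ℕ) :
    ∫ x, inner ℝ v x ^ (2 * k) ∂(stdGaussian E) = ((2 * k - 1).doubleFactorial : ℝ) := by
  rw [← integral_pow_two_mul_gaussianReal, ← map_inner_stdGaussian hv,
    integral_map (by fun_prop) (by fun_prop)]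

theorem isStep_stdGaussian : IsStep 1 (stdGaussian E) := by
  let b := stdOrthonormalBasis ℝ E
  have hb : ∀ x : E, ‖x‖ ^ 2 = ∑ i, inner ℝ (b i) x ^ 2 := fun x => (b.sum_sq_inner_right x).symm
  have hi : ∀ k : ℕ, Integrable (fun x => ‖x‖ ^ k) (stdGaussian E) := fun k =>
    (IsGaussian.memLp_id (stdGaussian E) k (by simp)).integrable_norm_pow'
  have hib : ∀ (v : E) (k : ℕ), Integrable (fun x => inner ℝ v x ^ k) (stdGaussian E) :=
    fun v k => integrable_of_abs_le_pow (hi k) (by fun_prop) (‖v‖ ^ k) fun x => by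
      rw [abs_pow]
      calc |inner ℝ v x| ^ k ≤ (‖v‖ * ‖x‖) ^ k := by gcongr; exact abs_real_inner_le_norm v x
        _ = ‖v‖ ^ k * ‖x‖ ^ k := by ring
        _ ≤ _ := by gcongr; linarith
  have mean : ∀ w : E, ∫ x, inner ℝ w x ∂(stdGaussian E) = 0 := fun w =>
    integral_strongDual_stdGaussian (innerSL ℝ w)
  have hd : ∀ k : ℕ, ∫ x, ∑ i, inner ℝ (b i) x ^ (2 * k) ∂(stdGaussian E)
      = Module.finrank ℝ E * ((2 * k - 1).doubleFactorial : ℝ) := fun k => by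
    rw [integral_finsetSum _ fun i _ => hib _ _]
    simp [integral_inner_pow_two_mul_stdGaussian (b.orthonormal.1 _)]
  -- Cauchy–Schwarz, once for `‖x‖⁴` and again for `‖x‖⁸`, reduces to coordinate moments `3!! = 3`
  -- and `7!! = 105`; this is where the constants of `HasMoments` and `IsStep` come from.
  have cs : ∀ f : Fin (Module.finrank ℝ E) → ℝ,
      (∑ i, f i) ^ 2 ≤ Module.finrank ℝ E * ∑ i, f i ^ 2 := fun f => by
    simpa using sq_sum_le_card_mul_sum_sq (s := Finset.univ) (f := f)
  have b4 : ∀ x : E, ‖x‖ ^ 4 ≤ Module.finrank ℝ E * ∑ i, inner ℝ (b i) x ^ (2 * 2) := fun x => by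
    calc ‖x‖ ^ 4 = (∑ i, inner ℝ (b i) x ^ 2) ^ 2 := by rw [← hb]; ring
      _ ≤ _ := (cs _).trans_eq (by simp_rw [← pow_mul])
  have b8 : ∀ x : E, ‖x‖ ^ 8 ≤ (Module.finrank ℝ E : ℝ) ^ 3 * ∑ i, inner ℝ (b i) x ^ (2 * 4) :=
    fun x => by
    calc ‖x‖ ^ 8 = (‖x‖ ^ 4) ^ 2 := by ring
      _ ≤ (Module.finrank ℝ E * ∑ i, inner ℝ (b i) x ^ (2 * 2)) ^ 2 := by gcongr; exact b4 x
      _ = (Module.finrank ℝ E : ℝ) ^ 2 * (∑ i, inner ℝ (b i) x ^ (2 * 2)) ^ 2 := by ring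
      _ ≤ (Module.finrank ℝ E : ℝ) ^ 2 * (Module.finrank ℝ E
          * ∑ i, (inner ℝ (b i) x ^ (2 * 2)) ^ 2) := by gcongr; exact cs _
      _ = _ := by simp_rw [← pow_mul]; ring
  refine ⟨⟨hi 4, mean, ?_, ?_⟩, ?_, fun w => ?_, hi 8, ?_⟩
  · simp_rw [hb]
    simpa using hd 1
  · refine (integral_mono (hi 4) ((integrable_finsetSum _ fun i _ => hib _ _).const_mul _)
      b4).trans ?_
    rw [integral_const_mul, hd]
    simp [Nat.doubleFactorial]
    nlinarith
  · exact stdGaussian_map (LinearIsometryEquiv.neg ℝ (E := E))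
  · have := variance_dual_stdGaussian (innerSL ℝ w)
    rw [variance_of_integral_eq_zero (X := innerSL ℝ w) (by fun_prop) (mean w),
      innerSL_apply_norm] at this
    simpa using this
  · refine (integral_mono (hi 8) ((integrable_finsetSum _ fun i _ => hib _ _).const_mul _)
      b8).trans ?_
    rw [integral_const_mul, hd]
    simp [Nat.doubleFactorial]
    nlinarith

theorem stdGaussian_map_smul_conv (a b c : ℝ) (habc : a ^ 2 + b ^ 2 = c ^ 2) :
    ((stdGaussian E).map fun x => a • x) ∗ ((stdGaussian E).map fun x => b • x)
      = (stdGaussian E).map fun x => c • x := by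
  have := Measure.isProbabilityMeasure_map (μ := stdGaussian E) (f := fun x => a • x) (by fun_prop)
  have := Measure.isProbabilityMeasure_map (μ := stdGaussian E) (f := fun x => b • x) (by fun_prop)
  have := Measure.isProbabilityMeasure_map (μ := stdGaussian E) (f := fun x => c • x) (by fun_prop)
  refine Measure.ext_of_charFun (funext fun t => ?_)
  rw [charFun_conv, charFun_map_smul, charFun_map_smul, charFun_map_smul]
  simp_rw [charFun_stdGaussian, ← Complex.exp_add, norm_smul, Real.norm_eq_abs]
  congr 1
  norm_cast
  simp_rw [mul_pow, sq_abs, ← habc]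
  ring

end StandardGaussian

/-! ### Lindeberg replacement. -/

section Replacement

variable {E : Type*} [NormedAddCommGroup E] [InnerProductSpace ℝ E] [MeasurableSpace E]
  [FiniteDimensional ℝ E] [BorelSpace E]

/-- The law of the sum of `k` independent random vectors with law `ν`. -/
def convPow {E : Type*} [AddMonoid E] [MeasurableSpace E] (ν : Measure E) : ℕ → Measure E
  | 0 => Measure.dirac 0
  | k + 1 => convPow ν k ∗ ν

instance isProbabilityMeasure_convPow (ν : Measure E) [IsProbabilityMeasure ν] (k : ℕ) :
    IsProbabilityMeasure (convPow ν k) := by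
  induction k with
  | zero => exact inferInstanceAs (IsProbabilityMeasure (Measure.dirac 0))
  | succ k ih => exact inferInstanceAs (IsProbabilityMeasure (convPow ν k ∗ ν))

theorem HasMoments.convPow {c : ℝ} {ν : Measure E} [IsProbabilityMeasure ν]
    (hν : HasMoments c ν) (k : ℕ) : HasMoments (k * c) (convPow ν k) := by
  induction k with
  | zero => simpa [Friedman.convPow] using hasMoments_dirac_zero
  | succ k ih =>
    have := ih.conv hν
    rw [← add_one_mul, ← Nat.cast_add_one] at this
    exact this

/-- Replacing one step `ν'` by a step `ν` with the same covariance. -/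
theorem IsStep.abs_integral_conv_sub_le {h : ℝ → ℝ} (hh : MemCb 4 h) {a c : ℝ}
    (ha0 : 0 ≤ a) (ha : a ≤ 1) (hc0 : 0 ≤ c) (hc : c ≤ 1)
    {U ν ν' : Measure E} [IsProbabilityMeasure U] [IsProbabilityMeasure ν]
    [IsProbabilityMeasure ν'] (hU : HasMoments a U) (hν : IsStep c ν) (hν' : IsStep c ν') :
    |∫ x, h (‖x‖ ^ 2) ∂(U ∗ ν) - ∫ x, h (‖x‖ ^ 2) ∂(U ∗ ν')|
      ≤ c ^ 2 * (Module.finrank ℝ E : ℝ) ^ 4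
        * (3 * derivSupNorm 2 h + 30 * derivSupNorm 3 h + 166 * derivSupNorm 4 h) := by
  have I := hh.integrable_comp_norm_sq (hU.conv hν.toHasMoments)
  have I' := hh.integrable_comp_norm_sq (hU.conv hν'.toHasMoments)
  have hm : ∀ ρ : Measure E, AEStronglyMeasurable (fun x : E => h (‖x‖ ^ 2)) ρ := fun ρ =>
    hh.continuous_comp_norm_sq.aestronglyMeasurable
  have J : Integrable (fun u => ∫ x, h (‖u + x‖ ^ 2) ∂ν) U := Integrable.integral_prod_left
    ((integrable_map_measure (hm _) (by fun_prop)).1 I)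
  have J' : Integrable (fun u => ∫ x, h (‖u + x‖ ^ 2) ∂ν') U := Integrable.integral_prod_left
    ((integrable_map_measure (hm _) (by fun_prop)).1 I')
  rw [integral_conv I, integral_conv I', ← integral_sub J J']
  set d : ℝ := (Module.finrank ℝ E : ℝ) with hd
  set D2 := derivSupNorm 2 h with hD2
  set D3 := derivSupNorm 3 h with hD3
  set D4 := derivSupNorm 4 h with hD4
  have n2 : 0 ≤ D2 := derivSupNorm_nonneg 2 h
  have n3 : 0 ≤ D3 := derivSupNorm_nonneg 3 h
  have n4 : 0 ≤ D4 := derivSupNorm_nonneg 4 h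
  have hb : ∀ u : E, ‖∫ x, h (‖u + x‖ ^ 2) ∂ν - ∫ x, h (‖u + x‖ ^ 2) ∂ν'‖
      ≤ (6 * (c * d) ^ 2 * (D2 / 2 + D3 / 12) + 2 * (D3 / 12 + D4 / 3) * (105 * (c * d) ^ 4)
        + 12 * (c * d) ^ 2 * D3 * ‖u‖ ^ 2) + 32 * (c * d) ^ 2 * D4 * ‖u‖ ^ 4 := by
    intro u
    have h1 := hν.abs_integral_sub_le hh u
    have h2 := hν'.abs_integral_sub_le hh u
    rw [Real.norm_eq_abs]
    rw [abs_le] at h1 h2 ⊢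
    constructor <;> linarith [h1.1, h1.2, h2.1, h2.2]
  have i2 : Integrable (fun u : E => ‖u‖ ^ 2) U := integrable_of_abs_le_pow hU.integrable
    (by fun_prop) 1 fun x => by
      rw [abs_of_nonneg (by positivity), one_mul]
      exact pow_le_one_add_pow (norm_nonneg x) (by norm_num)
  have j0 : Integrable (fun _ : E => 6 * (c * d) ^ 2 * (D2 / 2 + D3 / 12)
    + 2 * (D3 / 12 + D4 / 3) * (105 * (c * d) ^ 4)) U := integrable_const _
  have j2 := i2.const_mul (12 * (c * d) ^ 2 * D3)
  have j4 := hU.integrable.const_mul (32 * (c * d) ^ 2 * D4)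
  refine (norm_integral_le_of_norm_le ((j0.fun_add j2).fun_add j4)
    (Filter.Eventually.of_forall hb)).trans ?_
  rw [integral_add (j0.fun_add j2) j4, integral_add j0 j2, integral_const_mul, integral_const_mul,
    hU.sq, integral_const, probReal_univ, one_smul]
  have hd0 : 0 ≤ d := Nat.cast_nonneg _
  -- Raising powers of `d` to `d⁴` requires `d = 0` or `d ≥ 1`; the fourth power is forced by the
  -- eighth-moment term.
  have hdd : d = 0 ∨ 1 ≤ d := by
    rcases Nat.eq_zero_or_pos (Module.finrank ℝ E) with h0 | h0
    · left; simp [hd, h0]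
    · right; rw [hd]; exact_mod_cast h0
  have d2 : d ^ 2 ≤ d ^ 4 := by
    rcases hdd with h0 | h0
    · simp [h0]
    · exact pow_le_pow_right₀ h0 (by norm_num)
  have d3 : d ^ 3 ≤ d ^ 4 := by
    rcases hdd with h0 | h0
    · simp [h0]
    · exact pow_le_pow_right₀ h0 (by norm_num)
  have c4 : c ^ 4 ≤ c ^ 2 := pow_le_pow_of_le_one hc0 hc (by norm_num)
  have e1 : (c * d) ^ 2 ≤ c ^ 2 * d ^ 4 := by rw [mul_pow]; gcongr
  have e2 : (c * d) ^ 4 ≤ c ^ 2 * d ^ 4 := by rw [mul_pow]; gcongr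
  have e3 : (c * d) ^ 2 * (a * d) ≤ c ^ 2 * d ^ 4 := by
    calc (c * d) ^ 2 * (a * d) ≤ (c * d) ^ 2 * (1 * d) := by gcongr
      _ = c ^ 2 * d ^ 3 := by ring
      _ ≤ _ := by gcongr
  have e4 : (c * d) ^ 2 * ∫ u, ‖u‖ ^ 4 ∂U ≤ 3 * (c ^ 2 * d ^ 4) := by
    calc (c * d) ^ 2 * ∫ u, ‖u‖ ^ 4 ∂U ≤ (c * d) ^ 2 * (3 * (1 * d) ^ 2) := by
          gcongr; exact hU.four.trans (by gcongr)
      _ = _ := by ring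
  have f1 := mul_le_mul_of_nonneg_right e1 (show 0 ≤ 3 * D2 + D3 / 2 by positivity)
  have f2 := mul_le_mul_of_nonneg_right e2 (show 0 ≤ 35 / 2 * D3 + 70 * D4 by positivity)
  have f3 := mul_le_mul_of_nonneg_right e3 (show 0 ≤ 12 * D3 by positivity)
  have f4 := mul_le_mul_of_nonneg_right e4 (show 0 ≤ 32 * D4 by positivity)
  linarith

/-- Lindeberg's replacement argument. -/
theorem IsStep.abs_integral_convPow_sub_le {h : ℝ → ℝ} (hh : MemCb 4 h) {n : ℕ} (hn : 1 ≤ n)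
    {ν ν' : Measure E} [IsProbabilityMeasure ν] [IsProbabilityMeasure ν']
    (hν : IsStep (n : ℝ)⁻¹ ν) (hν' : IsStep (n : ℝ)⁻¹ ν') :
    |∫ x, h (‖x‖ ^ 2) ∂(convPow ν n) - ∫ x, h (‖x‖ ^ 2) ∂(convPow ν' n)|
      ≤ (n : ℝ)⁻¹ * (Module.finrank ℝ E : ℝ) ^ 4
        * (3 * derivSupNorm 2 h + 30 * derivSupNorm 3 h + 166 * derivSupNorm 4 h) := by
  have hn' : (0 : ℝ) < n := by exact_mod_cast hn
  set B := (Module.finrank ℝ E : ℝ) ^ 4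
        * (3 * derivSupNorm 2 h + 30 * derivSupNorm 3 h + 166 * derivSupNorm 4 h) with hB
  -- Hybrid sums: `k` steps of law `ν` followed by `n - k` of law `ν'`. Commutativity of convolution
  -- moves the step being exchanged to the end.
  have key : ∀ k ≤ n, |∫ x, h (‖x‖ ^ 2) ∂(convPow ν k ∗ convPow ν' (n - k))
      - ∫ x, h (‖x‖ ^ 2) ∂(convPow ν' n)| ≤ k * ((n : ℝ)⁻¹ ^ 2 * B) := by
    intro k
    induction k with
    | zero => simp [convPow]
    | succ k ih =>
      intro hk
      obtain ⟨m, rfl⟩ : ∃ m, n = k + 1 + m := ⟨n - (k + 1), by omega⟩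
      have ih := ih (by omega)
      rw [show k + 1 + m - (k + 1) = m by omega]
      rw [show k + 1 + m - k = m + 1 by omega] at ih
      have hU := (hν.toHasMoments.convPow k).conv (hν'.toHasMoments.convPow m)
      have h1 : convPow ν (k + 1) ∗ convPow ν' m = (convPow ν k ∗ convPow ν' m) ∗ ν := by
        rw [convPow, Measure.conv_assoc, Measure.conv_comm ν, ← Measure.conv_assoc]
      have h2 : convPow ν k ∗ convPow ν' (m + 1) = (convPow ν k ∗ convPow ν' m) ∗ ν' := by
        rw [convPow, ← Measure.conv_assoc]
      have hstep := IsStep.abs_integral_conv_sub_le hh (by positivity) (by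
        rw [← add_mul, ← div_eq_mul_inv, div_le_one hn']
        push_cast
        linarith) (by positivity) (by
        rw [inv_le_one₀ hn']; exact_mod_cast hn) hU hν hν'
      rw [← h1, ← h2, mul_assoc, ← hB] at hstep
      refine (abs_sub_le _ _ _).trans ((add_le_add hstep ih).trans ?_)
      push_cast
      linarith
  have := key n le_rfl
  rw [Nat.sub_self] at this
  simp only [convPow, Measure.conv_dirac_zero] at this
  refine this.trans_eq ?_
  field_simp
  ring

theorem convPow_map_smul_stdGaussian {n : ℕ} (hn : 1 ≤ n) :
    convPow ((stdGaussian E).map fun x => (√(n : ℝ))⁻¹ • x) n = stdGaussian E := by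
  have hn' : (0 : ℝ) < n := by exact_mod_cast hn
  have key : ∀ k : ℕ, convPow ((stdGaussian E).map fun x => (√(n : ℝ))⁻¹ • x) k
      = (stdGaussian E).map fun x => (√(k : ℝ) * (√(n : ℝ))⁻¹) • x := by
    intro k
    induction k with
    | zero => simp [convPow]
    | succ k ih =>
      rw [convPow, ih, stdGaussian_map_smul_conv _ _ (√((k + 1 : ℕ) : ℝ) * (√(n : ℝ))⁻¹)]
      rw [mul_pow, mul_pow, Real.sq_sqrt (Nat.cast_nonneg _), Real.sq_sqrt (Nat.cast_nonneg _)]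
      push_cast
      ring
  rw [key, mul_inv_cancel₀ (by positivity)]
  simp

/-- The central limit theorem for `h (‖·‖²)` with rate `1 / n`. -/
theorem IsStep.abs_integral_convPow_sub_stdGaussian_le {h : ℝ → ℝ} (hh : MemCb 4 h) {n : ℕ}
    (hn : 1 ≤ n) {ν : Measure E} [IsProbabilityMeasure ν] (hν : IsStep (n : ℝ)⁻¹ ν) :
    |∫ x, h (‖x‖ ^ 2) ∂(convPow ν n) - ∫ x, h (‖x‖ ^ 2) ∂(stdGaussian E)|
      ≤ (n : ℝ)⁻¹ * (Module.finrank ℝ E : ℝ) ^ 4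
        * (3 * derivSupNorm 2 h + 30 * derivSupNorm 3 h + 166 * derivSupNorm 4 h) := by
  have := Measure.isProbabilityMeasure_map (μ := stdGaussian E)
    (f := fun x => (√(n : ℝ))⁻¹ • x) (by fun_prop)
  have hg := isStep_stdGaussian.map_smul (E := E) (√(n : ℝ))⁻¹
  rw [inv_pow, Real.sq_sqrt (Nat.cast_nonneg n), mul_one] at hg
  have := IsStep.abs_integral_convPow_sub_le hh hn hν hg
  rwa [convPow_map_smul_stdGaussian hn] at this

end Replacement

/-! ### Rank vectors and their covariance. -/

/-- The second-moment matrix `c` is invariant under simultaneous relabelling of both indices, so it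
has one diagonal and one off-diagonal value. The trace fixes the first and the vanishing row sums
fix the second. Thus `c` is a multiple of the identity plus a multiple of the all-ones matrix, and
the latter kills `w`. -/
theorem sum_perm_sq {r : ℕ} (hr : 2 ≤ r) {a w : Fin r → ℝ} (ha : ∑ j, a j = 0)
    (hw : ∑ j, w j = 0) :
    ∑ σ : Equiv.Perm (Fin r), (∑ j, w j * a (σ j)) ^ 2
      = Nat.factorial r / ((r : ℝ) - 1) * (∑ j, a j ^ 2) * ∑ j, w j ^ 2 := by
  have hr0 : (0 : ℝ) < r := by exact_mod_cast (by omega : 0 < r)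
  have hr1 : (0 : ℝ) < (r : ℝ) - 1 := by
    have : (2 : ℝ) ≤ r := by exact_mod_cast hr
    linarith
  let c : Fin r → Fin r → ℝ := fun j k => ∑ σ : Equiv.Perm (Fin r), a (σ j) * a (σ k)
  have hinv : ∀ (τ : Equiv.Perm (Fin r)) j k, c (τ j) (τ k) = c j k := fun τ j k =>
    Equiv.sum_comp (Equiv.mulRight τ) fun σ : Equiv.Perm (Fin r) => a (σ j) * a (σ k)
  have hrow : ∀ j, ∑ k, c j k = 0 := fun j => by
    simp only [c]
    rw [Finset.sum_comm]
    simp_rw [← Finset.mul_sum]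
    refine Finset.sum_eq_zero fun σ _ => ?_
    rw [Equiv.sum_comp σ a, ha, mul_zero]
  have htrace : ∑ j, c j j = Nat.factorial r * ∑ j, a j ^ 2 := by
    simp only [c]
    rw [Finset.sum_comm]
    simp_rw [← sq]
    simp_rw [fun σ : Equiv.Perm (Fin r) => Equiv.sum_comp σ fun j => a j ^ 2]
    simp [Fintype.card_perm]
  have hdiag : ∀ j, c j j = Nat.factorial r * (∑ j, a j ^ 2) / r := fun j => by
    have h1 : ∀ k, c k k = c j j := fun k => by
      simpa using hinv (Equiv.swap j k) j j
    simp_rw [h1] at htrace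
    rw [← htrace]
    simp
    field_simp
  have hoff : ∀ j k, j ≠ k → c j k = -(Nat.factorial r * (∑ j, a j ^ 2) / r) / (r - 1) := by
    intro j k hjk
    have h1 : ∀ l ∈ Finset.univ.erase j, c j l = c j k := fun l hl => by
      -- The transposition of `k` and `l` fixes `j`, hence carries the entry `(j, k)` to `(j, l)`.
      have h2 := hinv (Equiv.swap k l) j k
      rw [Equiv.swap_apply_of_ne_of_ne hjk (Finset.ne_of_mem_erase hl).symm,
        Equiv.swap_apply_left] at h2
      exact h2
    have h3 := hrow j
    rw [← Finset.add_sum_erase _ _ (Finset.mem_univ j), Finset.sum_congr rfl h1, hdiag] at h3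
    rw [Finset.sum_const, Finset.card_erase_of_mem (Finset.mem_univ j), Finset.card_univ,
      Fintype.card_fin, nsmul_eq_mul, Nat.cast_sub (by omega), Nat.cast_one] at h3
    rw [eq_div_iff hr1.ne']
    linarith
  set α := Nat.factorial r * (∑ j, a j ^ 2) / r with hα
  have hc : ∀ j k, c j k = (if k = j then α * r / (r - 1) else 0) - α / (r - 1) := by
    intro j k
    split_ifs with h
    · rw [h, hdiag]; field_simp
    · rw [hoff j k (Ne.symm h)]; ring
  calc ∑ σ : Equiv.Perm (Fin r), (∑ j, w j * a (σ j)) ^ 2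
      = ∑ σ : Equiv.Perm (Fin r), ∑ j, ∑ k, w j * w k * (a (σ j) * a (σ k)) := by
        refine Finset.sum_congr rfl fun σ _ => ?_
        rw [sq, Finset.sum_mul_sum]
        refine Finset.sum_congr rfl fun j _ => Finset.sum_congr rfl fun k _ => by ring
    _ = ∑ j, ∑ k, w j * w k * c j k := by
        rw [Finset.sum_comm]
        refine Finset.sum_congr rfl fun j _ => ?_
        rw [Finset.sum_comm]
        simp_rw [c, Finset.mul_sum]
    _ = ∑ j, w j ^ 2 * (α * r / (r - 1)) := by
        refine Finset.sum_congr rfl fun j _ => ?_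
        simp_rw [hc, mul_sub, Finset.sum_sub_distrib, mul_ite, mul_zero]
        simp_rw [Finset.sum_ite_eq', ← Finset.sum_mul, ← Finset.mul_sum, hw]
        simp only [Finset.mem_univ, if_true, mul_zero, zero_mul, sub_zero]
        ring
    _ = _ := by
        rw [← Finset.sum_mul, hα]
        field_simp

theorem X_eq {r : ℕ} (σ : Equiv.Perm (Fin r)) (j : Fin r) : X σ j = X 1 (σ j) := rfl

theorem sum_X {r : ℕ} (σ : Equiv.Perm (Fin r)) : ∑ j, X σ j = 0 := by
  simp_rw [X_eq σ]
  rw [Equiv.sum_comp σ (X 1)]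
  simp only [X, Equiv.Perm.one_apply, ← Finset.mul_sum]
  have key : ∀ (c : ℝ) (m : ℕ), ∑ j ∈ Finset.range m, ((j : ℝ) + 1 - c)
      = m * (m + 1) / 2 - c * m := by
    intro c m
    induction m with
    | zero => simp
    | succ m ih => rw [Finset.sum_range_succ, ih]; push_cast; ring
  rw [Fin.sum_univ_eq_sum_range (fun j => (j : ℝ) + 1 - (r + 1) / 2), key]
  ring

/-- The factor `√12 / √(r(r+1))` is chosen for this: the total equals the dimension of the zero-sum
hyperplane, which makes the covariance there exactly the identity. -/
theorem sum_X_sq {r : ℕ} (hr : 1 ≤ r) (σ : Equiv.Perm (Fin r)) :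
    ∑ j, X σ j ^ 2 = (r : ℝ) - 1 := by
  have hr0 : (0 : ℝ) < r := by exact_mod_cast hr
  simp_rw [X_eq σ]
  rw [Equiv.sum_comp σ fun j => X 1 j ^ 2]
  simp only [X, Equiv.Perm.one_apply, mul_pow, ← Finset.mul_sum]
  have key : ∀ (c : ℝ) (m : ℕ), ∑ j ∈ Finset.range m, ((j : ℝ) + 1 - c) ^ 2
      = m * (m + 1) * (2 * m + 1) / 6 - c * (m * (m + 1)) + c ^ 2 * m := by
    intro c m
    induction m with
    | zero => simp
    | succ m ih => rw [Finset.sum_range_succ, ih]; push_cast; ring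
  rw [Fin.sum_univ_eq_sum_range (fun j => ((j : ℝ) + 1 - (r + 1) / 2) ^ 2), key, div_pow,
    Real.sq_sqrt (by norm_num), Real.sq_sqrt (by positivity)]
  field_simp
  ring

/-- Reversing the ranks, `k ↦ r + 1 - k`, reflects them about their mean; this is the source of the
symmetry of the step. -/
theorem X_revPerm_mul {r : ℕ} (σ : Equiv.Perm (Fin r)) (j : Fin r) :
    X (Fin.revPerm * σ) j = -X σ j := by
  have h1 : (σ j : ℕ) + 1 ≤ r := (σ j).2
  simp only [X, Equiv.Perm.mul_apply, Fin.revPerm_apply, Fin.val_rev]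
  rw [Nat.cast_sub h1]
  push_cast
  ring

/-- The vectors of `ℝ^r` whose coordinates sum to zero. -/
abbrev ZeroSum (r : ℕ) : Submodule ℝ (EuclideanSpace ℝ (Fin r)) :=
  (ℝ ∙ (WithLp.toLp 2 fun _ => (1 : ℝ) : EuclideanSpace ℝ (Fin r)))ᗮ

theorem mem_zeroSum {r : ℕ} {x : EuclideanSpace ℝ (Fin r)} : x ∈ ZeroSum r ↔ ∑ j, x j = 0 := by
  rw [Submodule.mem_orthogonal_singleton_iff_inner_right]
  simp [PiLp.inner_apply]

theorem finrank_zeroSum {r : ℕ} (hr : 1 ≤ r) : Module.finrank ℝ (ZeroSum r) = r - 1 := by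
  have : Fact (Module.finrank ℝ (EuclideanSpace ℝ (Fin r)) = (r - 1) + 1) :=
    ⟨by simp; omega⟩
  refine Submodule.finrank_orthogonal_span_singleton fun h => ?_
  have := congrArg (fun x : EuclideanSpace ℝ (Fin r) => x ⟨0, hr⟩) h
  simp at this

/-- The standardised ranking as a vector of the hyperplane `ZeroSum r`. -/
def rankVector {r : ℕ} (σ : Equiv.Perm (Fin r)) : ZeroSum r :=
  ⟨WithLp.toLp 2 (X σ), mem_zeroSum.2 (sum_X σ)⟩

theorem norm_rankVector_sq {r : ℕ} (hr : 1 ≤ r) (σ : Equiv.Perm (Fin r)) :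
    ‖rankVector σ‖ ^ 2 = (r : ℝ) - 1 := by
  rw [← sum_X_sq hr σ, Submodule.coe_norm, EuclideanSpace.real_norm_sq_eq]
  rfl

theorem rankVector_revPerm_mul {r : ℕ} (σ : Equiv.Perm (Fin r)) :
    rankVector (Fin.revPerm * σ) = -rankVector σ := by
  ext j
  exact X_revPerm_mul σ j

theorem sum_inner_rankVector_sq {r : ℕ} (hr : 2 ≤ r) (w : ZeroSum r) :
    ∑ σ : Equiv.Perm (Fin r), inner ℝ w (rankVector σ) ^ 2 = Nat.factorial r * ‖w‖ ^ 2 := by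
  have hr1 : (r : ℝ) - 1 ≠ 0 := by
    have : (2 : ℝ) ≤ r := by exact_mod_cast hr
    linarith
  have h1 : ∀ σ : Equiv.Perm (Fin r),
      inner ℝ w (rankVector σ) = ∑ j, (w : EuclideanSpace ℝ (Fin r)) j * X 1 (σ j) := fun σ => by
    rw [Submodule.coe_inner, PiLp.inner_apply]
    exact Finset.sum_congr rfl fun j _ => by simp [rankVector, X_eq σ, mul_comm]
  simp_rw [h1]
  rw [sum_perm_sq hr (sum_X 1) (mem_zeroSum.1 w.2), sum_X_sq (by omega), Submodule.coe_norm,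
    EuclideanSpace.real_norm_sq_eq]
  field_simp

theorem norm_sum_rankVector_sq {n r : ℕ} (ρ : Fin n → Equiv.Perm (Fin r)) :
    ‖∑ i, (√(n : ℝ))⁻¹ • rankVector (ρ i)‖ ^ 2 = friedman ρ := by
  rw [← Finset.smul_sum, Submodule.coe_norm, EuclideanSpace.real_norm_sq_eq, friedman]
  refine Finset.sum_congr rfl fun j _ => ?_
  simp [W, rankVector]

theorem chiSquared_eq_map {r : ℕ} (hr : 1 ≤ r) :
    chiSquared (r - 1) = (stdGaussian (ZeroSum r)).map fun x => ‖x‖ ^ 2 := by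
  let b : OrthonormalBasis (Fin (r - 1)) ℝ (ZeroSum r) :=
    (stdOrthonormalBasis ℝ (ZeroSum r)).reindex (finCongr (finrank_zeroSum hr))
  rw [stdGaussian_eq_map_pi_orthonormalBasis b, Measure.map_map (by fun_prop) (by fun_prop),
    chiSquared]
  congr 1
  funext z
  simp only [Function.comp_apply]
  rw [← b.sum_sq_inner_right]
  simp [inner_sum, inner_smul_right, b.inner_eq_ite]

/-! ### Laws under the null hypothesis. -/

section NullHypothesisLaw

variable {Ω : Type*} [MeasurableSpace Ω] {μ : Measure Ω} {n r : ℕ}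
  {π : Fin n → Ω → Equiv.Perm (Fin r)}

namespace NullHypothesis

theorem measurable_comp {F : Type*} [MeasurableSpace F] (hπ : NullHypothesis μ π) (i : Fin n)
    (f : Equiv.Perm (Fin r) → F) : Measurable fun ω => f (π i ω) := by
  let _ : MeasurableSpace (Equiv.Perm (Fin r)) := ⊤
  exact measurable_from_top.comp (measurable_to_countable' (hπ.measurable i))

theorem integrable_comp [IsProbabilityMeasure μ] (hπ : NullHypothesis μ π) (i : Fin n)
    (f : Equiv.Perm (Fin r) → ℝ) :
    Integrable (fun ω => f (π i ω)) μ := by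
  refine Integrable.of_bound (hπ.measurable_comp i f).aestronglyMeasurable (∑ σ, |f σ|)
    (Filter.Eventually.of_forall fun ω => ?_)
  exact Finset.single_le_sum (f := fun σ => |f σ|) (fun σ _ => abs_nonneg _) (Finset.mem_univ _)

theorem integral_comp [IsProbabilityMeasure μ] (hπ : NullHypothesis μ π) (i : Fin n)
    (f : Equiv.Perm (Fin r) → ℝ) :
    ∫ ω, f (π i ω) ∂μ = (Nat.factorial r : ℝ)⁻¹ * ∑ σ, f σ := by
  classical
  have h1 : ∀ ω, f (π i ω) = ∑ σ, (π i ⁻¹' {σ}).indicator (fun _ => f σ) ω := fun ω => by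
    simp [indicator_apply]
  simp_rw [h1]
  rw [integral_finsetSum _ fun σ _ => (integrable_const _).indicator (hπ.measurable i σ),
    Finset.mul_sum]
  refine Finset.sum_congr rfl fun σ _ => ?_
  rw [integral_indicator_const _ (hπ.measurable i σ), hπ.uniform, smul_eq_mul, one_div]

theorem map_comp_eq [IsProbabilityMeasure μ] {F : Type*} [MeasurableSpace F]
    (hπ : NullHypothesis μ π) (i j : Fin n)
    (f : Equiv.Perm (Fin r) → F) :
    μ.map (fun ω => f (π i ω)) = μ.map fun ω => f (π j ω) := by
  have key : ∀ (k : Fin n) (s : Set F), MeasurableSet s →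
      (μ.map fun ω => f (π k ω)).real s
        = (Nat.factorial r : ℝ)⁻¹ * ∑ σ, s.indicator (fun _ => (1 : ℝ)) (f σ) := by
    intro k s hs
    rw [map_measureReal_apply (hπ.measurable_comp k f) hs, ← hπ.integral_comp k,
      ← integral_indicator_one (hπ.measurable_comp k f hs)]
    rfl
  have := Measure.isProbabilityMeasure_map (hπ.measurable_comp i f).aemeasurable (μ := μ)
  have := Measure.isProbabilityMeasure_map (hπ.measurable_comp j f).aemeasurable (μ := μ)
  refine Measure.ext fun s hs => ?_
  rw [← measureReal_eq_measureReal_iff, key i s hs, key j s hs]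

theorem map_sum_comp_eq_convPow {E : Type*} [NormedAddCommGroup E] [InnerProductSpace ℝ E]
    [FiniteDimensional ℝ E] [MeasurableSpace E] [BorelSpace E]
    [IsProbabilityMeasure μ] (hπ : NullHypothesis μ π)
    (f : Equiv.Perm (Fin r) → E) (i₀ : Fin n) (s : Finset (Fin n)) :
    μ.map (fun ω => ∑ i ∈ s, f (π i ω)) = convPow (μ.map fun ω => f (π i₀ ω)) s.card := by
  classical
  have hind : iIndepFun (fun i ω => f (π i ω)) μ := hπ.indep.comp (fun _ => f) fun _ =>
    measurable_from_top
  have hm : ∀ i, Measurable fun ω => f (π i ω) := fun i => hπ.measurable_comp i f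
  induction s using Finset.induction_on with
  | empty => simp [convPow]
  | insert i s his ih =>
    have h3 : (∑ j ∈ s, fun ω => f (π j ω)) = fun ω => ∑ j ∈ s, f (π j ω) := by
      funext ω
      simp
    have h0 := hind.indepFun_finsetSum_of_notMem hm his
    rw [h3] at h0
    have h1 := h0.map_add_eq_map_conv_map (Finset.measurable_sum _ fun j _ => hm j) (hm i)
    have h2 : (fun ω => ∑ j ∈ s, f (π j ω)) + (fun ω => f (π i ω))
        = fun ω => ∑ j ∈ insert i s, f (π j ω) := by
      funext ω
      simp [Finset.sum_insert his, add_comm]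
    rw [h2, ih, hπ.map_comp_eq i i₀] at h1
    rw [h1, Finset.card_insert_of_notMem his, convPow]

theorem isStep_rankVector [IsProbabilityMeasure μ] (hπ : NullHypothesis μ π) (hr : 2 ≤ r)
    (i : Fin n) : IsStep 1 (μ.map fun ω => rankVector (π i ω)) := by
  have hm := hπ.measurable_comp i rankVector
  have hd : (Module.finrank ℝ (ZeroSum r) : ℝ) = (r : ℝ) - 1 := by
    rw [finrank_zeroSum (by omega), Nat.cast_sub (by omega), Nat.cast_one]
  have hint : ∀ f : ZeroSum r → ℝ, Continuous f →
      Integrable f (μ.map fun ω => rankVector (π i ω)) := fun f hf =>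
    (integrable_map_measure hf.aestronglyMeasurable hm.aemeasurable).2
      (hπ.integrable_comp i fun σ => f (rankVector σ))
  have hI : ∀ f : ZeroSum r → ℝ, Continuous f →
      ∫ x, f x ∂(μ.map fun ω => rankVector (π i ω))
        = (Nat.factorial r : ℝ)⁻¹ * ∑ σ, f (rankVector σ) := fun f hf => by
    rw [integral_map hm.aemeasurable hf.aestronglyMeasurable,
      hπ.integral_comp i fun σ => f (rankVector σ)]
  have hnorm : ∀ k : ℕ, ∫ x, ‖x‖ ^ (2 * k) ∂(μ.map fun ω => rankVector (π i ω))
      = ((r : ℝ) - 1) ^ k := fun k => by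
    rw [hI _ (by fun_prop)]
    simp_rw [pow_mul, norm_rankVector_sq (show 1 ≤ r by omega)]
    simp [Fintype.card_perm]
    field_simp
  have hsymm : (μ.map fun ω => rankVector (π i ω)).map (fun x => -x)
      = μ.map fun ω => rankVector (π i ω) := by
    have := Measure.isProbabilityMeasure_map hm.aemeasurable (μ := μ)
    have := Measure.isProbabilityMeasure_map (μ := μ.map fun ω => rankVector (π i ω))
      (f := fun x => -x) (by fun_prop)
    refine ext_of_forall_integral_eq_of_IsFiniteMeasure fun f => ?_
    rw [integral_map (by fun_prop) (by fun_prop), hI _ (by fun_prop), hI _ (by fun_prop)]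
    simp_rw [← rankVector_revPerm_mul]
    congr 1
    exact Equiv.sum_comp (Equiv.mulLeft (Fin.revPerm : Equiv.Perm (Fin r)))
      fun σ => f (rankVector σ)
  have hr1 : (0 : ℝ) ≤ (r : ℝ) - 1 := hd ▸ Nat.cast_nonneg _
  refine ⟨⟨hint _ (by fun_prop), fun w => ?_, ?_, ?_⟩, hsymm, fun w => ?_, hint _ (by fun_prop), ?_⟩
  · exact integral_eq_zero_of_odd hsymm (by fun_prop) fun x => inner_neg_right w x
  · rw [hd]; simpa using hnorm 1
  · rw [hd]
    exact (hnorm 2).trans_le (by nlinarith)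
  · rw [hI _ (by fun_prop), sum_inner_rankVector_sq hr]
    field_simp
  · rw [hd]
    exact (hnorm 4).trans_le (by nlinarith [pow_nonneg hr1 4])

end NullHypothesis

theorem hNorm_four (h : ℝ → ℝ) : hNorm 4 h = derivSupNorm 1 h + 7 * derivSupNorm 2 h
    + 6 * derivSupNorm 3 h + derivSupNorm 4 h := by
  simp [hNorm, Finset.sum_Icc_succ_top, Nat.stirlingSecond]

end NullHypothesisLaw

end Friedman

end

/-! ### Conclusion. -/

theorem mainTheorem1 {Ω : Type*} [MeasurableSpace Ω] (μ : Measure Ω) [IsProbabilityMeasure μ]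
    (n r : ℕ) (hn : 1 ≤ n) (hr : 2 ≤ r)
    (π : Fin n → Ω → Equiv.Perm (Fin r)) (hπ : Friedman.NullHypothesis μ π)
    (h : ℝ → ℝ) (hh : Friedman.MemCb 4 h) :
    Integrable (fun ω => h (Friedman.friedman fun i => π i ω)) μ ∧
    Integrable h (Friedman.chiSquared (r - 1)) ∧
    |∫ ω, h (Friedman.friedman fun i => π i ω) ∂μ - ∫ y, h y ∂(Friedman.chiSquared (r - 1))|
      ≤ 10797 * (r : ℝ) ^ 5 * (n : ℝ)⁻¹ * Friedman.hNorm 4 h := by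
  open Friedman in
  have hr1 : 1 ≤ r := by omega
  let f : Equiv.Perm (Fin r) → ZeroSum r := fun σ => (√(n : ℝ))⁻¹ • rankVector σ
  let i₀ : Fin n := ⟨0, hn⟩
  have hf : Measurable fun ω => f (π i₀ ω) := hπ.measurable_comp i₀ f
  have := Measure.isProbabilityMeasure_map hf.aemeasurable (μ := μ)
  have hstep : IsStep (n : ℝ)⁻¹ (μ.map fun ω => f (π i₀ ω)) := by
    have := (hπ.isStep_rankVector hr i₀).map_smul (√(n : ℝ))⁻¹
    rw [inv_pow, Real.sq_sqrt (Nat.cast_nonneg n), mul_one,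
      Measure.map_map (by fun_prop) (hπ.measurable_comp i₀ rankVector)] at this
    exact this
  have hsum : Measurable fun ω => ∑ i, f (π i ω) :=
    Finset.measurable_sum _ fun i _ => hπ.measurable_comp i f
  have hlaw := hπ.map_sum_comp_eq_convPow f i₀ Finset.univ
  rw [Finset.card_univ, Fintype.card_fin] at hlaw
  have hfr : ∀ ω, h (friedman fun i => π i ω) = h (‖∑ i, f (π i ω)‖ ^ 2) := fun ω => by
    rw [← norm_sum_rankVector_sq]
  have hcont : Continuous fun x : ZeroSum r => h (‖x‖ ^ 2) := hh.continuous_comp_norm_sq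
  -- Nothing is known of `h` on the negative axis, so measurability uses that the chi-square law is
  -- carried by `[0, ∞)`.
  have hcsm : AEStronglyMeasurable h (chiSquared (r - 1)) := by
    have hpos : ∀ᵐ y ∂(chiSquared (r - 1)), y ∈ Ici (0 : ℝ) := by
      rw [chiSquared_eq_map hr1]
      exact (ae_map_iff (by fun_prop) measurableSet_Ici).2
        (Filter.Eventually.of_forall fun x => sq_nonneg ‖x‖)
    rw [← Measure.restrict_eq_self_of_ae_mem hpos]
    exact hh.continuousOn.aestronglyMeasurable measurableSet_Ici
  have hG := hh.integrable_comp_norm_sq (isStep_stdGaussian (E := ZeroSum r)).toHasMoments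
  refine ⟨?_, ?_, ?_⟩
  · simp_rw [hfr]
    have := hh.integrable_comp_norm_sq (hstep.toHasMoments.convPow n)
    rw [← hlaw] at this
    exact (integrable_map_measure hcont.aestronglyMeasurable hsum.aemeasurable).1 this
  · rw [chiSquared_eq_map hr1] at hcsm ⊢
    exact (integrable_map_measure hcsm (by fun_prop)).2 hG
  · have key := hstep.abs_integral_convPow_sub_stdGaussian_le hh hn
    rw [← hlaw, integral_map hsum.aemeasurable hcont.aestronglyMeasurable,
      finrank_zeroSum hr1] at key
    simp_rw [hfr]
    have hchi : ∫ y, h y ∂(chiSquared (r - 1)) = ∫ x, h (‖x‖ ^ 2) ∂(stdGaussian (ZeroSum r)) := by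
      rw [chiSquared_eq_map hr1] at hcsm ⊢
      exact integral_map (by fun_prop) hcsm
    rw [hchi]
    refine key.trans ?_
    have n1 := derivSupNorm_nonneg 1 h
    have n2 := derivSupNorm_nonneg 2 h
    have n3 := derivSupNorm_nonneg 3 h
    have n4 := derivSupNorm_nonneg 4 h
    have hrr : (1 : ℝ) ≤ r := by exact_mod_cast hr1
    have hpow : ((r - 1 : ℕ) : ℝ) ^ 4 ≤ (r : ℝ) ^ 5 :=
      calc ((r - 1 : ℕ) : ℝ) ^ 4 ≤ (r : ℝ) ^ 4 := by gcongr; omega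
        _ ≤ (r : ℝ) ^ 5 := pow_le_pow_right₀ hrr (by norm_num)
    -- Coefficientwise, 3, 30 and 166 lie far below `10797` times 7, 6 and 1.
    calc (n : ℝ)⁻¹ * ((r - 1 : ℕ) : ℝ) ^ 4
          * (3 * derivSupNorm 2 h + 30 * derivSupNorm 3 h + 166 * derivSupNorm 4 h)
        ≤ (n : ℝ)⁻¹ * (r : ℝ) ^ 5 * (10797 * hNorm 4 h) := by
          rw [hNorm_four]
          gcongr
          linarith
      _ = _ := by ring
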